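/- Let $S^2\subset\mathbb R^3$ be the round unit sphere and let $P\subset S^2$ be a convex spherical polygon contained in an open hemisphere, with $p\ge 3$ nondegenerate vertices $v_i$, $i\in\mathbb Z/p$, listed counterclockwise. Let $-P$ be the antipodal polygon and let $X=S^2\setminus(P\cup -P)$. For each $i$ let $R_i\subset X$ be the geodesic ray that extends the side $v_iv_{i+1}$ beyond $v_i$ (it runs from $v_i$ to $-v_{i+1}$). The rays $R_i$ cut $X$ into $p$ open convex faces: the face $X_i$ is the open lune with corners $v_i$ and $-v_i$ that lies between $R_{i-1}$ and $R_i$. The outer billiard about $P$ is the piecewise isometry $T$ that on $X_i$ is the geodesic symmetry $x\mapsto 2\langle v_i,x\rangle v_i-x$ about $v_i$. A point $x\in X$ is regular if $x,Tx,T^2x,\dots$ all lie in open faces; its code is the sequence of indices of the faces containing these points. Let $f(n)$ be the number of words of length $n$ over the alphabet $\mathbb Z/p$ that occur in the codes of regular points (the complexity of the outer billiard about $P$). Then $f$ grows subexponentially: $f(n)>0$ for all $n$, and for every $h>0$ one has $f(n)<e^{hn}$ and $f(n)^{-1}<e^{hn}$ for all sufficiently large $n$. -/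

import Mathlib

noncomputable section

namespace SphericalOuterBilliard

/-- The round unit sphere in Euclidean 3-space. -/
abbrev Sphere2 : Type := Metric.sphere (0 : EuclideanSpace ℝ (Fin 3)) 1

/-- The determinant of three vectors of Euclidean 3-space. For linearly independent `a`, `b` on the
sphere, `0 < triple a b x` says that `x` lies strictly to the left of the great circle through `a`
and `b`, oriented from `a` to `b` (the sphere being seen from outside). -/
def triple (x y z : EuclideanSpace ℝ (Fin 3)) : ℝ :=
  Matrix.det (Matrix.of ![x.ofLp, y.ofLp, z.ofLp])

/-- The intersection of the closed hemispheres to the left of the consecutive sides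
`v i, v (i + 1)` of a cyclic list of points of the sphere. -/
def leftOfSides {p : ℕ} (v : ZMod p → Sphere2) : Set Sphere2 :=
  {x | ∀ i, 0 ≤ triple (v i) (v (i + 1)) x}

/-- A convex spherical polygon with `p` vertices, listed counterclockwise (indices modulo `p`),
contained in an open hemisphere. Vertices are nondegenerate: no vertex lies on the great circle
spanned by a side that does not contain it. -/
structure ConvexPolygon (p : ℕ) where
  vertex : ZMod p → Sphere2
  three_le : 3 ≤ p
  convex : ∀ i j, j ≠ i → j ≠ i + 1 → 0 < triple (vertex i) (vertex (i + 1)) (vertex j)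
  hemisphere : ∃ u : Sphere2, ∀ x ∈ leftOfSides vertex,
    0 < inner ℝ (u : EuclideanSpace ℝ (Fin 3)) (x : EuclideanSpace ℝ (Fin 3))

/-- The geodesic symmetry of the sphere about the point `a`, that is, the rotation by `π` about
the axis through `a`. -/
def geodesicSymmetry (a x : Sphere2) : Sphere2 :=
  ⟨Submodule.reflection (Submodule.span ℝ {(a : EuclideanSpace ℝ (Fin 3))}) x, by simp⟩

namespace ConvexPolygon

variable {p : ℕ} (P : ConvexPolygon p)

/-- The polygon as a closed subset of the sphere. -/
def body : Set Sphere2 := leftOfSides P.vertex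

/-- The phase space of the outer billiard: the sphere without the polygon and its antipode. -/
def phaseSpace : Set Sphere2 := {x | x ∉ P.body ∧ -x ∉ P.body}

/-- The geodesic ray in the phase space that extends the side `v i, v (i + 1)` beyond `v i`;
it runs from `v i` to the antipode of `v (i + 1)`, both excluded. -/
def ray (i : ZMod p) : Set Sphere2 :=
  {x | ∃ s t : ℝ, 0 < s ∧ 0 < t ∧
    (x : EuclideanSpace ℝ (Fin 3)) = s • (P.vertex i).val - t • (P.vertex (i + 1)).val}

/-- The open face with corner `v i` of the partition of the phase space by the rays: the open
lune with corners `v i` and its antipode, lying between the rays `i - 1` and `i`. -/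
def face (i : ZMod p) : Set Sphere2 :=
  {x | triple (P.vertex (i - 1)) (P.vertex i) x < 0 ∧
    0 < triple (P.vertex i) (P.vertex (i + 1)) x}

open Classical in
/-- The outer billiard map: on the open face with corner `v i` it is the geodesic symmetry
about `v i` (the faces are disjoint, see `face_unique`). It is set to the identity off the open
faces, where it is never used. -/
def outerBilliard (x : Sphere2) : Sphere2 :=
  if h : ∃ i, x ∈ P.face i then geodesicSymmetry (P.vertex h.choose) x else x

/-- A point is regular if its whole forward orbit lies in the open faces. -/
def IsRegular (x : Sphere2) : Prop :=
  ∀ k : ℕ, ∃ i, P.outerBilliard^[k] x ∈ P.face i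

/-- The words of length `n` that occur in the codes of regular points by faces. -/
def words (n : ℕ) : Set (Fin n → ZMod p) :=
  {w | ∃ x, P.IsRegular x ∧ ∃ m : ℕ, ∀ k : Fin n, P.outerBilliard^[m + k] x ∈ P.face (w k)}

/-- The complexity of the outer billiard about `P`. -/
def complexity (n : ℕ) : ℕ := (P.words n).ncard

/-! Consistency of the definitions: the open faces are pairwise disjoint, and they are what
remains of the phase space after the rays are removed. -/

theorem triple_corner_pos (i : ZMod p) :
    0 < triple (P.vertex (i - 1)) (P.vertex i) (P.vertex (i + 1)) := by
  have h3 := P.three_le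
  have : Fact (1 < p) := ⟨by omega⟩
  have h1 : (1 : ZMod p) ≠ 0 := one_ne_zero
  have h2 : (2 : ZMod p) ≠ 0 := by
    intro h
    have := (ZMod.natCast_eq_zero_iff 2 p).1 (by exact_mod_cast h)
    have := Nat.le_of_dvd (by norm_num) this
    omega
  have hA := P.convex (i - 1) (i + 1) (fun h => h2 (by linear_combination h))
    (fun h => h1 (by linear_combination h))
  rwa [sub_add_cancel] at hA

/-- Seen from a point of the open face with corner `v i`, the polygon lies to the left of the
great circle through that point and `v i`. -/
theorem triple_face_pos {x : Sphere2} {i k : ZMod p} (hx : x ∈ P.face i) (hk : k ≠ i) :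
    0 < triple x (P.vertex i) (P.vertex k) := by
  have hA := P.triple_corner_pos i
  have hB : k ≠ i - 1 → 0 < triple (P.vertex (i - 1)) (P.vertex i) (P.vertex k) := by
    intro h
    have := P.convex (i - 1) k h (by rwa [sub_add_cancel])
    rwa [sub_add_cancel] at this
  have hC : k ≠ i + 1 → 0 < triple (P.vertex i) (P.vertex (i + 1)) (P.vertex k) :=
    fun h => P.convex i k hk h
  have hid : triple x (P.vertex i) (P.vertex k) *
      triple (P.vertex (i - 1)) (P.vertex i) (P.vertex (i + 1)) =
      triple (P.vertex (i - 1)) (P.vertex i) (P.vertex k) *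
        triple (P.vertex i) (P.vertex (i + 1)) x +
      triple (P.vertex i) (P.vertex (i + 1)) (P.vertex k) *
        -triple (P.vertex (i - 1)) (P.vertex i) x := by
    simp only [triple, Matrix.det_fin_three, Matrix.of_apply, Matrix.cons_val]
    ring
  obtain ⟨hx1, hx2⟩ := hx
  refine pos_of_mul_pos_left ?_ hA.le
  rw [hid]
  by_cases ha : k = i - 1
  · have h0 : triple (P.vertex (i - 1)) (P.vertex i) (P.vertex k) = 0 := by
      rw [ha]
      simp only [triple, Matrix.det_fin_three, Matrix.of_apply, Matrix.cons_val]
      ring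
    have hc : 0 < triple (P.vertex i) (P.vertex (i + 1)) (P.vertex k) := by
      have h : triple (P.vertex i) (P.vertex (i + 1)) (P.vertex k) =
          triple (P.vertex (i - 1)) (P.vertex i) (P.vertex (i + 1)) := by
        rw [ha]
        simp only [triple, Matrix.det_fin_three, Matrix.of_apply, Matrix.cons_val]
        ring
      rwa [h]
    rw [h0, zero_mul, zero_add]
    exact mul_pos hc (neg_pos.2 hx1)
  · have hc : 0 ≤ triple (P.vertex i) (P.vertex (i + 1)) (P.vertex k) := by
      by_cases hk' : k = i + 1
      · rw [hk']
        apply le_of_eq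
        simp only [triple, Matrix.det_fin_three, Matrix.of_apply, Matrix.cons_val]
        ring
      · exact (hC hk').le
    exact add_pos_of_pos_of_nonneg (mul_pos (hB ha) hx2) (mul_nonneg hc (neg_pos.2 hx1).le)

theorem face_unique {x : Sphere2} {i j : ZMod p} (hi : x ∈ P.face i) (hj : x ∈ P.face j) :
    i = j := by
  by_contra hne
  have h1 := P.triple_face_pos hi (Ne.symm hne)
  have h2 := P.triple_face_pos hj hne
  have h3 : triple x (P.vertex j) (P.vertex i) = -triple x (P.vertex i) (P.vertex j) := by
    simp only [triple, Matrix.det_fin_three, Matrix.of_apply, Matrix.cons_val]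
    ring
  linarith

theorem iUnion_face : ⋃ i, P.face i = P.phaseSpace \ ⋃ i, P.ray i := by
  have hneg : ∀ (a b : EuclideanSpace ℝ (Fin 3)) (x : Sphere2),
      triple a b (-x : Sphere2) = -triple a b x := by
    intro a b x
    simp only [triple, Matrix.det_fin_three, Matrix.of_apply, Matrix.cons_val]
    simp
    ring
  ext x
  simp only [Set.mem_iUnion, Set.mem_sdiff, not_exists]
  constructor
  · rintro ⟨i, hi⟩
    refine ⟨⟨fun h => ?_, fun h => ?_⟩, ?_⟩
    · have := h (i - 1)
      rw [sub_add_cancel] at this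
      exact absurd hi.1 (not_lt.2 this)
    · have := h i
      rw [hneg] at this
      linarith [hi.2]
    · rintro j ⟨s, t, hs, ht, hst⟩
      have h0 : triple (P.vertex j) (P.vertex (j + 1)) x = 0 := by
        rw [hst]
        simp only [triple, Matrix.det_fin_three, Matrix.of_apply, Matrix.cons_val]
        simp
        ring
      by_cases h1 : i = j
      · have := hi.2
        rw [h1, h0] at this
        exact lt_irrefl _ this
      by_cases h2 : i = j + 1
      · have := hi.1
        rw [h2, add_sub_cancel_right, h0] at this
        exact lt_irrefl _ this
      have h3 := P.triple_face_pos hi (Ne.symm h1)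
      have h4 : triple x (P.vertex i) (P.vertex j) =
          -(t * triple (P.vertex j) (P.vertex (j + 1)) (P.vertex i)) := by
        rw [hst]
        simp only [triple, Matrix.det_fin_three, Matrix.of_apply, Matrix.cons_val]
        simp
        ring
      have h5 := mul_pos ht (P.convex j i h1 h2)
      linarith
  · rintro ⟨⟨hx1, hx2⟩, hx3⟩
    have hx1' : ∃ j, triple (P.vertex j) (P.vertex (j + 1)) x < 0 := by
      by_contra! h
      exact hx1 h
    have hx2' : ∃ j, 0 < triple (P.vertex j) (P.vertex (j + 1)) x := by
      by_contra! h
      exact hx2 fun j => by rw [hneg]; linarith [h j]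
    obtain ⟨i, hi1, hi2⟩ : ∃ i, triple (P.vertex (i - 1)) (P.vertex i) x < 0 ∧
        0 ≤ triple (P.vertex i) (P.vertex (i + 1)) x := by
      by_contra! h
      obtain ⟨j, hj⟩ := hx1'
      obtain ⟨k, hk⟩ := hx2'
      have hind : ∀ n : ℕ, triple (P.vertex (j + n)) (P.vertex (j + n + 1)) x < 0 := by
        intro n
        induction n with
        | zero => simpa using hj
        | succ n ih =>
          have := h (j + n + 1) (by rwa [add_sub_cancel_right])
          rw [Nat.cast_succ, ← add_assoc]
          exact this
      have h3 := P.three_le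
      have : NeZero p := ⟨by omega⟩
      have := hind (k - j).val
      rw [ZMod.natCast_zmod_val, add_sub_cancel] at this
      linarith
    refine ⟨i, hi1, lt_of_le_of_ne hi2 fun h0 => ?_⟩
    have hD := P.triple_corner_pos i
    set D := triple (P.vertex (i - 1)) (P.vertex i) (P.vertex (i + 1)) with hDdef
    set S := triple (P.vertex (i - 1)) x (P.vertex (i + 1)) with hSdef
    set U := triple (P.vertex (i - 1)) (P.vertex i) x with hUdef
    have hb : D • (x : EuclideanSpace ℝ (Fin 3)) =
        S • (P.vertex i).val + U • (P.vertex (i + 1)).val := by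
      have h : D • (x : EuclideanSpace ℝ (Fin 3)) =
          triple (P.vertex i) (P.vertex (i + 1)) x • (P.vertex (i - 1)).val +
            S • (P.vertex i).val + U • (P.vertex (i + 1)).val := by
        rw [hDdef, hSdef, hUdef]
        ext k
        fin_cases k <;> simp [triple, Matrix.det_fin_three] <;> ring
      rw [h, ← h0, zero_smul, zero_add]
    have hx : (x : EuclideanSpace ℝ (Fin 3)) =
        (S / D) • (P.vertex i).val - (-U / D) • (P.vertex (i + 1)).val := by
      have h : (x : EuclideanSpace ℝ (Fin 3)) =
          D⁻¹ • (D • (x : EuclideanSpace ℝ (Fin 3))) := by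
        rw [smul_smul, inv_mul_cancel₀ hD.ne', one_smul]
      rw [h, hb]
      module
    have ht : 0 < -U / D := div_pos (neg_pos.2 hi1) hD
    rcases lt_or_ge 0 (S / D) with hs | hs
    · exact hx3 i ⟨_, _, hs, ht, hx⟩
    · refine hx2 fun j => ?_
      rw [hneg]
      have hnn : ∀ k, 0 ≤ triple (P.vertex j) (P.vertex (j + 1)) (P.vertex k) := by
        intro k
        by_cases h1 : k = j
        · apply le_of_eq
          rw [h1]
          simp only [triple, Matrix.det_fin_three, Matrix.of_apply, Matrix.cons_val]
          ring
        by_cases h2 : k = j + 1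
        · apply le_of_eq
          rw [h2]
          simp only [triple, Matrix.det_fin_three, Matrix.of_apply, Matrix.cons_val]
          ring
        exact (P.convex j k h1 h2).le
      have he : -triple (P.vertex j) (P.vertex (j + 1)) x =
          -(S / D) * triple (P.vertex j) (P.vertex (j + 1)) (P.vertex i) +
            (-U / D) * triple (P.vertex j) (P.vertex (j + 1)) (P.vertex (i + 1)) := by
        generalize S / D = s at *
        generalize -U / D = t at *
        rw [hx]
        simp only [triple, Matrix.det_fin_three, Matrix.of_apply, Matrix.cons_val]
        simp
        ring
      rw [he]
      exact add_nonneg (mul_nonneg (neg_nonneg.2 hs) (hnn i)) (mul_nonneg ht.le (hnn _))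

end ConvexPolygon

/-- A positive function `s` is subexponential if for every `h > 0` both `s n < exp (h * n)` and
`1 / s n < exp (h * n)` for all sufficiently large `n`. -/
def IsSubexponential (s : ℕ → ℝ) : Prop :=
  (∀ n, 0 < s n) ∧ ∀ h : ℝ, 0 < h →
    ∀ᶠ n : ℕ in Filter.atTop, s n < Real.exp (h * n) ∧ (s n)⁻¹ < Real.exp (h * n)

end SphericalOuterBilliard

end

/-!
The lower bound only asks for one regular point. A point of an open face is regular as soon as it
avoids countably many great circles, the preimages of the circles carrying the sides under
compositions of the vertex symmetries; by Baire such points exist (`exists_isRegular`).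

The upper bound holds for every piecewise isometry of the sphere with finitely many pieces cut out
by great circles (`PiecewiseIsometry.exists_ncard_code_le_exp`). The great circles that matter for
the first `m` steps, pulled back to time zero, are the *walls* of level `m`. They are finite in
number, and their signs at a point determine its first `m` symbols. Two observations
bound the number of words.

* A set smaller than the Lebesgue number of a suitable cover meets only walls of level `m` that
  pass through one point `z` (`exists_isLocal`). Isometries do not enlarge small sets, so if a
  small set shows at most `M` words of length `m`, then it shows at most `M ^ j` words of length
  `j * m` (`ncard_itinerary_blocks_le`, `exists_ncard_code_le`).
* Among the finitely many walls of level `n`, two that pass through a common point and are distinct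
  make an angle bounded below. Hence a sufficiently narrow sector at `z` is met by at most one of
  the walls through `z` and shows at most three words of length `n`, one for each side of the wall
  and one for the wall itself (`ncard_code_sector_le`). The isometries preserve the angle of the
  sector, so as long as only walls through `z` matter, it shows at most `3 ^ k` words of length
  `k * n` (`ncard_code_sector_mul_le`). The number `K` of sectors depends only on `n`.

So a small set shows at most `M = K * 3 ^ k` words of length `m = k * n`, and the exponential growth
rate is at most `log M / m = log K / (k * n) + log 3 / n`, which is arbitrarily small.
-/

namespace SphericalOuterBilliard

open Set Filter Topology

/-! ### Itineraries and counting of words -/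

section Itinerary

variable {X ι : Type*} (T : X → X) (c : X → ι)

/-- The list of the first `n` symbols of the itinerary of a point under `T`, with respect to the
partition into the level sets of `c`. -/
def itinerary : ℕ → X → List ι
  | 0, _ => []
  | n + 1, x => c x :: itinerary n (T x)

@[simp]
theorem length_itinerary (n : ℕ) (x : X) : (itinerary T c n x).length = n := by
  induction n generalizing x with
  | zero => rfl
  | succ n ih => simp [itinerary, ih]

theorem itinerary_add (n m : ℕ) (x : X) :
    itinerary T c (n + m) x = itinerary T c n x ++ itinerary T c m (T^[n] x) := by
  induction n generalizing x with
  | zero => simp [itinerary]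
  | succ n ih => rw [Nat.succ_add, itinerary, ih, itinerary]; simp

theorem itinerary_eq_ofFn (n : ℕ) (x : X) :
    itinerary T c n x = List.ofFn fun k : Fin n => c (T^[k] x) := by
  induction n generalizing x with
  | zero => simp [itinerary]
  | succ n ih => simp [itinerary, ih, List.ofFn_succ]

theorem finite_image_itinerary [Finite ι] (n : ℕ) (S : Set X) :
    (itinerary T c n '' S).Finite :=
  (List.finite_length_eq ι n).subset (by rintro _ ⟨x, -, rfl⟩; exact length_itinerary T c n x)

/-- If every set of points sharing their first `j * n` symbols shows at most `B` words during the
next `n` steps, then the number of words of length `k * n` is at most `B ^ k`. -/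
theorem ncard_itinerary_blocks_le [Finite ι] {n B : ℕ} (k : ℕ) (S : Set X)
    (hB : ∀ j < k, ∀ u : List ι, u.length = j * n →
      (itinerary T c n '' (T^[j * n] '' {x ∈ S | itinerary T c (j * n) x = u})).ncard ≤ B) :
    (itinerary T c (k * n) '' S).ncard ≤ B ^ k := by
  classical
  induction k with
  | zero =>
    simp only [pow_zero, zero_mul]
    refine (ncard_le_ncard (t := {[]}) ?_ (finite_singleton _)).trans (ncard_singleton _).le
    rintro _ ⟨x, -, rfl⟩
    rfl
  | succ k ih =>
    have ih := ih fun j hj => hB j (hj.trans k.lt_succ_self)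
    set W := (finite_image_itinerary T c (k * n) S).toFinset with hW
    let V : List ι → Set X := fun u => T^[k * n] '' {x ∈ S | itinerary T c (k * n) x = u}
    let F : List ι → Finset (List ι) := fun u =>
      (finite_image_itinerary T c n (V u)).toFinset.image (u ++ ·)
    have hsub : itinerary T c ((k + 1) * n) '' S ⊆ (W.biUnion F : Finset (List ι)) := by
      rintro _ ⟨x, hx, rfl⟩
      simp only [Finset.coe_biUnion, mem_iUnion, hW, F, Finset.coe_image, Finite.coe_toFinset]
      refine ⟨itinerary T c (k * n) x, mem_image_of_mem _ hx,
        itinerary T c n (T^[k * n] x), ⟨_, ⟨x, ⟨hx, rfl⟩, rfl⟩, rfl⟩, ?_⟩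
      rw [add_mul, one_mul, itinerary_add]
    refine (ncard_le_ncard hsub (Finset.finite_toSet _)).trans ?_
    rw [ncard_coe_finset, pow_succ]
    refine (Finset.card_biUnion_le_card_mul W F B fun u hu => ?_).trans ?_
    · refine Finset.card_image_le.trans ?_
      rw [← ncard_eq_toFinset_card _ (finite_image_itinerary T c n (V u))]
      refine hB k k.lt_succ_self u ?_
      obtain ⟨x, -, rfl⟩ := (Finite.mem_toFinset _).1 hu
      exact length_itinerary T c _ x
    · rw [ncard_eq_toFinset_card _ (finite_image_itinerary T c (k * n) S)] at ih
      exact Nat.mul_le_mul_right _ ih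

theorem ncard_image_itinerary_mono [Finite ι] {n m : ℕ} (h : n ≤ m) (S : Set X) :
    (itinerary T c n '' S).ncard ≤ (itinerary T c m '' S).ncard := by
  have : itinerary T c n '' S = List.take n '' (itinerary T c m '' S) := by
    rw [image_image]
    refine image_congr fun x _ => ?_
    obtain ⟨r, rfl⟩ := Nat.exists_eq_add_of_le h
    rw [itinerary_add, List.take_left' (length_itinerary T c n x)]
  rw [this]
  exact ncard_image_le (finite_image_itinerary T c m S)

/-- A map that on `S` is a function of a sign takes at most three values on `S`. -/
theorem ncard_image_le_three {β : Type*} {f : X → β} {s : X → SignType} {S : Set X}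
    (h : ∀ x ∈ S, ∀ y ∈ S, s x = s y → f x = f y) : (f '' S).ncard ≤ 3 := by
  rcases S.eq_empty_or_nonempty with rfl | ⟨x₀, -⟩
  · simp
  have : Nonempty X := ⟨x₀⟩
  have h3 : (s '' S).ncard ≤ 3 := (ncard_le_card _).trans (by simp; decide)
  choose! r hr hr' using fun σ (hσ : σ ∈ s '' S) => hσ
  have hsub : f '' S ⊆ (f ∘ r) '' (s '' S) := by
    rintro _ ⟨x, hx, rfl⟩
    have hx' := mem_image_of_mem s hx
    exact ⟨s x, hx', h _ (hr _ hx') _ hx (hr' _ hx')⟩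
  exact (ncard_le_ncard hsub).trans ((ncard_image_le).trans h3)

end Itinerary

/-! ### Directions and almost parallel vectors in Euclidean 3-space -/

section Space

/-- Euclidean 3-space. -/
abbrev Space : Type := EuclideanSpace ℝ (Fin 3)

/-- The projection of `x` to the plane orthogonal to the unit vector `z`, normalized. It is the
direction in which the point `x` of the sphere is seen from the point `z`; for `x` on the axis
through `z` it is zero. -/
noncomputable def direction (z x : Space) : Space :=
  ‖x - inner ℝ z x • z‖⁻¹ • (x - inner ℝ z x • z)

theorem norm_direction_le (z x : Space) : ‖direction z x‖ ≤ 1 := by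
  rw [direction, norm_smul, norm_inv, norm_norm]
  exact inv_mul_le_one

theorem direction_map (R : Space ≃ₗᵢ[ℝ] Space) (z x : Space) :
    direction (R z) (R x) = R (direction z x) := by
  simp only [direction, R.inner_map_map, ← map_smul, ← map_sub, R.norm_map]

theorem inner_direction {z a : Space} (h : inner ℝ a z = 0) (x : Space) :
    inner ℝ a (direction z x) = ‖x - inner ℝ z x • z‖⁻¹ * inner ℝ a x := by
  rw [direction, inner_smul_right, inner_sub_right, inner_smul_right, h]
  simp

theorem sign_inner_direction {z a : Space} (h : inner ℝ a z = 0) (x : Space) :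
    SignType.sign (inner ℝ a (direction z x)) = SignType.sign (inner ℝ a x) := by
  rw [inner_direction h]
  by_cases h0 : x - inner ℝ z x • z = 0
  · have : inner ℝ a x = 0 := by
      rw [sub_eq_zero.1 h0, inner_smul_right, h, mul_zero]
    simp [this]
  · rw [sign_mul, sign_pos (inv_pos.2 (norm_pos_iff.2 h0)), one_mul]

theorem norm_direction {z a x : Space} (h : inner ℝ a z = 0) (hx : inner ℝ a x ≠ 0) :
    ‖direction z x‖ = 1 := by
  have h0 : x - inner ℝ z x • z ≠ 0 := fun h0 => hx <| by
    rw [sub_eq_zero.1 h0, inner_smul_right, h, mul_zero]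
  rw [direction, norm_smul, norm_inv, norm_norm, inv_mul_cancel₀ (norm_ne_zero_iff.2 h0)]

theorem inner_direction_self {z : Space} (hz : ‖z‖ = 1) (x : Space) :
    inner ℝ z (direction z x) = 0 := by
  rw [direction, inner_smul_right, inner_sub_right, inner_smul_right,
    real_inner_self_eq_norm_sq, hz]
  simp

/-- In the plane orthogonal to `z`, two vectors that are almost orthogonal to the unit vector `e`
are almost parallel: their Gram determinant is small. -/
theorem gram_le_of_almost_orthogonal {z e a b : Space} {δ : ℝ} (hz : ‖z‖ = 1) (he : ‖e‖ = 1)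
    (hze : inner ℝ z e = 0) (ha : inner ℝ a z = 0) (hb : inner ℝ b z = 0)
    (hae : |inner ℝ a e| ≤ δ * ‖a‖) (hbe : |inner ℝ b e| ≤ δ * ‖b‖) :
    (‖a‖ * ‖b‖) ^ 2 - (inner ℝ a b) ^ 2 ≤ (2 * δ * (‖a‖ * ‖b‖)) ^ 2 := by
  have ho : Orthonormal ℝ (({0, 1} : Set (Fin 3)).domRestrict ![z, e, 0]) := by
    rw [orthonormal_iff_ite]
    rintro ⟨i, hi⟩ ⟨j, hj⟩
    simp only [mem_insert_iff, mem_singleton_iff] at hi hj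
    rcases hi with rfl | rfl <;> rcases hj with rfl | rfl <;>
      simp [hz, he, hze, real_inner_comm]
  obtain ⟨B, hB⟩ := ho.exists_orthonormalBasis_extension_of_card_eq (by simp)
  have hB0 : B 0 = z := hB 0 (by simp)
  have hB1 : B 1 = e := hB 1 (by simp)
  have hexp : ∀ x y : Space, inner ℝ x z = 0 → inner ℝ x y =
      inner ℝ x e * inner ℝ y e + inner ℝ x (B 2) * inner ℝ y (B 2) := by
    intro x y hx
    rw [← B.sum_inner_mul_inner x y, Fin.sum_univ_three, hB0, hB1, hx, real_inner_comm y e,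
      real_inner_comm y (B 2)]
    ring
  have haa := hexp a a ha
  have hbb := hexp b b hb
  have hab := hexp a b ha
  rw [real_inner_self_eq_norm_sq] at haa hbb
  have h2 : ∀ x : Space, |inner ℝ x (B 2)| ≤ ‖x‖ := fun x => by
    simpa using abs_real_inner_le_norm x (B 2)
  have hdet : |inner ℝ a e * inner ℝ b (B 2) - inner ℝ a (B 2) * inner ℝ b e| ≤
      2 * δ * (‖a‖ * ‖b‖) := by
    refine (abs_sub _ _).trans ?_
    rw [abs_mul, abs_mul]
    have h3 := mul_le_mul hae (h2 b) (abs_nonneg _) ((abs_nonneg _).trans hae)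
    have h4 := mul_le_mul (h2 a) hbe (abs_nonneg _) (norm_nonneg _)
    linarith
  rw [mul_pow, haa, hbb, hab]
  refine le_trans (le_of_eq ?_) (sq_le_sq' (neg_le_of_abs_le hdet) (le_of_abs_le hdet))
  ring

theorem eq_smul_of_gram_nonpos {a b : Space} (ha : a ≠ 0)
    (h : (‖a‖ * ‖b‖) ^ 2 - (inner ℝ a b) ^ 2 ≤ 0) : ∃ t : ℝ, b = t • a := by
  by_cases hb : b = 0
  · exact ⟨0, by simp [hb]⟩
  have h1 : |inner ℝ a b| = ‖a‖ * ‖b‖ := by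
    refine le_antisymm (abs_real_inner_le_norm a b) ?_
    refine abs_le_of_sq_le_sq' ?_ (abs_nonneg _) |>.2
    rw [sq_abs]
    linarith
  have h2 : |inner ℝ a b / (‖a‖ * ‖b‖)| = 1 := by
    rw [abs_div, abs_of_nonneg (by positivity : 0 ≤ ‖a‖ * ‖b‖), h1]
    exact div_self (mul_ne_zero (norm_ne_zero_iff.2 ha) (norm_ne_zero_iff.2 hb))
  obtain ⟨-, t, -, ht⟩ := (abs_real_inner_div_norm_mul_norm_eq_one_iff a b).1 h2
  exact ⟨t, ht⟩

/-- For every finite set of vectors there is `δ > 0` such that two of them that lie in a common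
plane and are `δ`-almost orthogonal to the same unit vector of that plane are parallel. -/
theorem exists_parallel_of_almost_orthogonal {A : Set Space} (hA : A.Finite) :
    ∃ δ : ℝ, 0 < δ ∧ ∀ a ∈ A, ∀ b ∈ A, ∀ z e : Space, a ≠ 0 → ‖z‖ = 1 → ‖e‖ = 1 →
      inner ℝ z e = 0 → inner ℝ a z = 0 → inner ℝ b z = 0 →
      |inner ℝ a e| ≤ δ * ‖a‖ → |inner ℝ b e| ≤ δ * ‖b‖ → ∃ t : ℝ, b = t • a := by
  have key : ∀ᶠ δ : ℝ in 𝓝[>] 0, ∀ a ∈ A, ∀ b ∈ A,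
      (0 : ℝ) < (‖a‖ * ‖b‖) ^ 2 - (inner ℝ a b) ^ 2 →
      (2 * δ * (‖a‖ * ‖b‖)) ^ 2 < (‖a‖ * ‖b‖) ^ 2 - (inner ℝ a b) ^ 2 := by
    rw [eventually_all_finite hA]
    intro a _
    rw [eventually_all_finite hA]
    intro b _
    by_cases h : (0 : ℝ) < (‖a‖ * ‖b‖) ^ 2 - (inner ℝ a b) ^ 2
    · have hc : Tendsto (fun δ : ℝ => (2 * δ * (‖a‖ * ‖b‖)) ^ 2) (𝓝[>] 0) (𝓝 0) := by
        have : Continuous fun δ : ℝ => (2 * δ * (‖a‖ * ‖b‖)) ^ 2 := by fun_prop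
        simpa using (this.tendsto 0).mono_left nhdsWithin_le_nhds
      exact (hc.eventually_lt_const h).mono fun δ hδ _ => hδ
    · exact Eventually.of_forall fun δ h' => absurd h' h
  obtain ⟨δ, hδ, hδ0⟩ := (key.and self_mem_nhdsWithin).exists
  refine ⟨δ, hδ0, fun a ha b hb z e ha0 hz he hze haz hbz hae hbe => ?_⟩
  refine eq_smul_of_gram_nonpos ha0 (not_lt.1 fun hpos => ?_)
  exact absurd (gram_le_of_almost_orthogonal hz he hze haz hbz hae hbe)
    (not_le.2 (hδ a ha b hb hpos))

theorem abs_le_abs_sub_of_sign_ne {s t : ℝ} (h : SignType.sign s ≠ SignType.sign t) :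
    |s| ≤ |s - t| := by
  rcases lt_trichotomy s 0 with hs | rfl | hs
  · have ht : 0 ≤ t := not_lt.1 fun ht => h (by rw [sign_neg hs, sign_neg ht])
    rw [abs_of_neg hs, abs_of_nonpos (by linarith)]
    linarith
  · simp
  · have ht : t ≤ 0 := not_lt.1 fun ht => h (by rw [sign_pos hs, sign_pos ht])
    rw [abs_of_pos hs, abs_of_nonneg (by linarith)]
    linarith

theorem dense_setOf_inner_ne_zero {a : Space} (ha : a ≠ 0) :
    Dense {x : Space | inner ℝ a x ≠ 0} := by
  have hint : interior ((ℝ ∙ a)ᗮ : Set Space) = ∅ := by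
    by_contra h
    have htop := Submodule.eq_top_of_nonempty_interior' _ (nonempty_iff_ne_empty.2 h)
    have haa : a ∈ (ℝ ∙ a)ᗮ := htop ▸ Submodule.mem_top
    exact ha (inner_self_eq_zero.1 (Submodule.mem_orthogonal_singleton_iff_inner_right.1 haa))
  have hsub : ((ℝ ∙ a)ᗮ : Set Space)ᶜ ⊆ {x : Space | inner ℝ a x ≠ 0} := fun x hx h =>
    hx (Submodule.mem_orthogonal_singleton_iff_inner_right.2 h)
  exact (interior_eq_empty_iff_dense_compl.1 hint).mono hsub

end Space

/-! ### Piecewise isometries of the sphere -/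

/-- A piecewise isometry of a set `X` of points of the unit sphere, with finitely many pieces cut
out by great circles: `map` moves the points of each `piece` by a rotation or reflection `rot`,
and the piece of a point is determined by the signs of its inner products with finitely many
vectors `normal`. -/
structure PiecewiseIsometry (X ι : Type*) where
  map : X → X
  piece : X → ι
  pos : X → Space
  rot : ι → Space ≃ₗᵢ[ℝ] Space
  normal : ι → Space
  norm_pos : ∀ x, ‖pos x‖ = 1
  pos_map : ∀ x, pos (map x) = rot (piece x) (pos x)
  piece_eq_of_sign : ∀ x y,
    (∀ i, SignType.sign (inner ℝ (normal i) (pos x)) =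
      SignType.sign (inner ℝ (normal i) (pos y))) → piece x = piece y

namespace PiecewiseIsometry

variable {X ι : Type*} (D : PiecewiseIsometry X ι)

/-- The word of the first `n` pieces visited by the orbit of `x`. -/
abbrev code (n : ℕ) (x : X) : List ι := itinerary D.map D.piece n x

/-- The isometry that acts along a word, the first letter acting first. -/
noncomputable def rotWord : List ι → Space ≃ₗᵢ[ℝ] Space
  | [] => LinearIsometryEquiv.refl ℝ Space
  | i :: u => (D.rot i).trans (rotWord u)

theorem rotWord_append (u v : List ι) (x : Space) :
    D.rotWord (u ++ v) x = D.rotWord v (D.rotWord u x) := by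
  induction u generalizing x with
  | nil => rfl
  | cons i u ih => exact ih _

/-- The normal vector of the `i`-th great circle, pulled back along the word `u`. -/
noncomputable def wall (w : List ι × ι) : Space := (D.rotWord w.1).symm (D.normal w.2)

/-- The indices of the walls of level `n`: those that have a bearing on the first `n` pieces
visited. -/
def wallIndex (ι : Type*) (n : ℕ) : Set (List ι × ι) := {w | w.1.length < n}

theorem finite_wallIndex [Finite ι] (n : ℕ) : (wallIndex ι n).Finite :=
  ((List.finite_length_lt ι n).prod (finite_univ (α := ι))).subset fun _ hw => ⟨hw, mem_univ _⟩

theorem inner_wall (w : List ι × ι) (x : Space) :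
    inner ℝ (D.wall w) x = inner ℝ (D.normal w.2) (D.rotWord w.1 x) := by
  rw [wall, ← (D.rotWord w.1).inner_map_map, LinearIsometryEquiv.apply_symm_apply]

theorem inner_wall_append (u : List ι) (w : List ι × ι) (x : Space) :
    inner ℝ (D.wall (u ++ w.1, w.2)) x = inner ℝ (D.wall w) (D.rotWord u x) := by
  rw [inner_wall, inner_wall, rotWord_append]

theorem pos_iterate (n : ℕ) (x : X) :
    D.pos (D.map^[n] x) = D.rotWord (D.code n x) (D.pos x) := by
  induction n generalizing x with
  | zero => rfl
  | succ n ih =>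
    rw [Function.iterate_succ_apply, ih, pos_map]
    rfl

theorem code_eq_of_sign (n : ℕ) (x y : X)
    (h : ∀ w ∈ wallIndex ι n, SignType.sign (inner ℝ (D.wall w) (D.pos x)) =
      SignType.sign (inner ℝ (D.wall w) (D.pos y))) : D.code n x = D.code n y := by
  induction n generalizing x y with
  | zero => rfl
  | succ n ih =>
    have h0 : D.piece x = D.piece y :=
      D.piece_eq_of_sign x y fun i => h ([], i) n.succ_pos
    have h1 : D.code n (D.map x) = D.code n (D.map y) := by
      refine ih _ _ fun w hw => ?_
      have h2 := h (D.piece x :: w.1, w.2) (Nat.succ_lt_succ hw)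
      rw [inner_wall, inner_wall] at h2
      rw [inner_wall, inner_wall, pos_map, pos_map, ← h0]
      exact h2
    simp only [code, itinerary]
    rw [h0]
    exact congrArg _ h1

/-- `D.IsLocal n z S` says that no wall of level `n` separates points of `S`, except walls through
the point `z`. -/
def IsLocal (n : ℕ) (z : Space) (S : Set X) : Prop :=
  ∀ w ∈ wallIndex ι n, inner ℝ (D.wall w) z = 0 ∨
    ∀ x ∈ S, ∀ y ∈ S, SignType.sign (inner ℝ (D.wall w) (D.pos x)) =
      SignType.sign (inner ℝ (D.wall w) (D.pos y))

/-- Seen from `z`, the points of `S` lie in a narrow sector. All the walls that separate them are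
multiples of a single one, so that the position relative to this one determines the code. -/
theorem ncard_code_sector_le {n : ℕ} {δ : ℝ}
    (hδ : ∀ w ∈ wallIndex ι n, ∀ w' ∈ wallIndex ι n, ∀ z e : Space, D.wall w ≠ 0 →
      ‖z‖ = 1 → ‖e‖ = 1 → inner ℝ z e = 0 → inner ℝ (D.wall w) z = 0 →
      inner ℝ (D.wall w') z = 0 → |inner ℝ (D.wall w) e| ≤ δ * ‖D.wall w‖ →
      |inner ℝ (D.wall w') e| ≤ δ * ‖D.wall w'‖ → ∃ t : ℝ, D.wall w' = t • D.wall w)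
    {z : Space} (hz : ‖z‖ = 1) {S : Set X} (hS : D.IsLocal n z S)
    (hsec : ∀ x ∈ S, ∀ y ∈ S, ‖direction z (D.pos x) - direction z (D.pos y)‖ ≤ δ) :
    (D.code n '' S).ncard ≤ 3 := by
  by_cases hall : ∀ w ∈ wallIndex ι n, ∀ x ∈ S, ∀ y ∈ S,
      SignType.sign (inner ℝ (D.wall w) (D.pos x)) = SignType.sign (inner ℝ (D.wall w) (D.pos y))
  · exact ncard_image_le_three (s := fun _ => 0) fun x hx y hy _ =>
      D.code_eq_of_sign n x y fun w hw => hall w hw x hx y hy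
  push Not at hall
  obtain ⟨w, hw, x₁, hx₁, x₂, hx₂, hne⟩ := hall
  have hwz : inner ℝ (D.wall w) z = 0 :=
    (hS w hw).resolve_right fun h => hne (h x₁ hx₁ x₂ hx₂)
  obtain ⟨x₀, hx₀, h0⟩ : ∃ x ∈ S, inner ℝ (D.wall w) (D.pos x) ≠ 0 := by
    by_contra! h
    exact hne (by rw [h x₁ hx₁, h x₂ hx₂])
  set e := direction z (D.pos x₀) with he
  have hw0 : D.wall w ≠ 0 := fun h => h0 (by rw [h, inner_zero_left])
  -- A wall that separates points of `S` passes within `δ` of the direction `e`.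
  have halmost : ∀ v, inner ℝ (D.wall v) z = 0 → ∀ x ∈ S, ∀ y ∈ S,
      SignType.sign (inner ℝ (D.wall v) (D.pos x)) ≠
        SignType.sign (inner ℝ (D.wall v) (D.pos y)) →
      |inner ℝ (D.wall v) e| ≤ δ * ‖D.wall v‖ := by
    intro v hv x hx y hy hxy
    obtain ⟨x', hx', hs⟩ : ∃ x' ∈ S, SignType.sign (inner ℝ (D.wall v) e) ≠
        SignType.sign (inner ℝ (D.wall v) (direction z (D.pos x'))) := by
      by_contra! h
      have h' := (h x hx).symm.trans (h y hy)
      rw [sign_inner_direction hv, sign_inner_direction hv] at h'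
      exact hxy h'
    refine (abs_le_abs_sub_of_sign_ne hs).trans ?_
    rw [← inner_sub_right, mul_comm]
    exact (abs_real_inner_le_norm _ _).trans
      (mul_le_mul_of_nonneg_left (hsec _ hx₀ _ hx') (norm_nonneg _))
  refine ncard_image_le_three (s := fun x => SignType.sign (inner ℝ (D.wall w) (D.pos x)))
    fun x hx y hy hxy => D.code_eq_of_sign n x y fun w' hw' => ?_
  rcases hS w' hw' with hw'z | hconst
  · by_contra hne'
    obtain ⟨t, ht⟩ := hδ w hw w' hw' z e hw0 hz (norm_direction hwz h0)
      (inner_direction_self hz _) hwz hw'z (halmost w hwz x₁ hx₁ x₂ hx₂ hne)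
      (halmost w' hw'z x hx y hy hne')
    refine hne' ?_
    rw [ht, real_inner_smul_left, real_inner_smul_left, sign_mul, sign_mul, hxy]
  · exact hconst x hx y hy

/-- The sector shape of a set is preserved by the isometries, so that the bound for `n` steps can
be iterated as long as the set meets only walls through `z`. -/
theorem ncard_code_sector_mul_le [Finite ι] {n : ℕ} {δ : ℝ}
    (hδ : ∀ w ∈ wallIndex ι n, ∀ w' ∈ wallIndex ι n, ∀ z e : Space, D.wall w ≠ 0 →
      ‖z‖ = 1 → ‖e‖ = 1 → inner ℝ z e = 0 → inner ℝ (D.wall w) z = 0 →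
      inner ℝ (D.wall w') z = 0 → |inner ℝ (D.wall w) e| ≤ δ * ‖D.wall w‖ →
      |inner ℝ (D.wall w') e| ≤ δ * ‖D.wall w'‖ → ∃ t : ℝ, D.wall w' = t • D.wall w)
    {z : Space} (hz : ‖z‖ = 1) {S : Set X} (k : ℕ) (hS : D.IsLocal (k * n) z S)
    (hsec : ∀ x ∈ S, ∀ y ∈ S, ‖direction z (D.pos x) - direction z (D.pos y)‖ ≤ δ) :
    (D.code (k * n) '' S).ncard ≤ 3 ^ k := by
  refine ncard_itinerary_blocks_le _ _ k S fun j hj u hu => ?_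
  have hpos : ∀ x, D.code (j * n) x = u → D.pos (D.map^[j * n] x) = D.rotWord u (D.pos x) :=
    fun x hx => by rw [pos_iterate, hx]
  refine D.ncard_code_sector_le hδ (z := D.rotWord u z) (by simpa using hz) ?_ ?_
  · intro w hw
    have hlen : (u ++ w.1, w.2) ∈ wallIndex ι (k * n) := by
      have h1 : (j + 1) * n ≤ k * n := Nat.mul_le_mul_right n hj
      have h2 : w.1.length < n := hw
      simp only [wallIndex, mem_ofPred_eq, List.length_append, hu]
      linarith
    refine (hS _ hlen).imp (fun h => by rwa [inner_wall_append] at h) fun h => ?_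
    rintro _ ⟨x, ⟨hx, hxu⟩, rfl⟩ _ ⟨y, ⟨hy, hyu⟩, rfl⟩
    rw [hpos x hxu, hpos y hyu, ← inner_wall_append, ← inner_wall_append]
    exact h x hx y hy
  · rintro _ ⟨x, ⟨hx, hxu⟩, rfl⟩ _ ⟨y, ⟨hy, hyu⟩, rfl⟩
    rw [hpos x hxu, hpos y hyu, direction_map, direction_map, ← map_sub,
      LinearIsometryEquiv.norm_map]
    exact hsec x hx y hy

/-- All sufficiently small sets are local. -/
theorem exists_isLocal [Finite ι] (m : ℕ) :
    ∃ ε : ℝ, 0 < ε ∧ ∀ c : Space, ‖c‖ = 1 → ∃ z : Space, ‖z‖ = 1 ∧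
      ∀ S : Set X, (∀ x ∈ S, D.pos x ∈ Metric.ball c ε) → D.IsLocal m z S := by
  have hloc : ∀ z : Space, ∃ r : ℝ, 0 < r ∧ ∀ w ∈ wallIndex ι m, inner ℝ (D.wall w) z = 0 ∨
      ∀ y ∈ Metric.ball z r, SignType.sign (inner ℝ (D.wall w) y) =
        SignType.sign (inner ℝ (D.wall w) z) := by
    intro z
    have hev : ∀ᶠ y in 𝓝 z, ∀ w ∈ wallIndex ι m, inner ℝ (D.wall w) z ≠ 0 →
        SignType.sign (inner ℝ (D.wall w) y) = SignType.sign (inner ℝ (D.wall w) z) := by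
      rw [eventually_all_finite (finite_wallIndex m)]
      intro w _
      have hc : Tendsto (fun y => inner ℝ (D.wall w) y) (𝓝 z) (𝓝 (inner ℝ (D.wall w) z)) :=
        Continuous.tendsto (by fun_prop) z
      rcases lt_trichotomy (inner ℝ (D.wall w) z) 0 with h | h | h
      · filter_upwards [hc.eventually_lt_const h] with y hy _
        rw [sign_neg hy, sign_neg h]
      · exact Eventually.of_forall fun y h' => absurd h h'
      · filter_upwards [hc.eventually_const_lt h] with y hy _
        rw [sign_pos hy, sign_pos h]
    obtain ⟨r, hr, hball⟩ := Metric.eventually_nhds_iff_ball.1 hev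
    exact ⟨r, hr, fun w hw => or_iff_not_imp_left.2 fun h y hy => hball y hy w hw h⟩
  choose r hr hball using hloc
  obtain ⟨ε, hε, hcov⟩ := lebesgue_number_lemma_of_metric
    (c := fun z : Metric.sphere (0 : Space) 1 => Metric.ball (z : Space) (r z))
    (isCompact_sphere (0 : Space) 1) (fun _ => Metric.isOpen_ball) fun z hz =>
      mem_iUnion.2 ⟨⟨z, hz⟩, Metric.mem_ball_self (hr z)⟩
  refine ⟨ε, hε, fun c hc => ?_⟩
  obtain ⟨z, hz⟩ := hcov c (by simpa using hc)
  refine ⟨z, norm_eq_of_mem_sphere z, fun S hS w hw => (hball z w hw).imp_right fun h x hx y hy => ?_⟩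
  rw [h _ (hz (hS x hx)), h _ (hz (hS y hy))]

/-- The number of words of length `k * n` in a sufficiently small set. The factor `K` is the number
of sectors needed to see the set from a point; it does not depend on `k`. -/
theorem exists_ncard_code_ball_le [Finite ι] (n : ℕ) :
    ∃ K : ℕ, ∀ k : ℕ, ∃ ε : ℝ, 0 < ε ∧ ∀ c : Space, ‖c‖ = 1 → ∀ S : Set X,
      (∀ x ∈ S, D.pos x ∈ Metric.ball c ε) → (D.code (k * n) '' S).ncard ≤ K * 3 ^ k := by
  obtain ⟨δ, hδ, hpar⟩ := exists_parallel_of_almost_orthogonal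
    ((finite_wallIndex (ι := ι) n).image D.wall)
  obtain ⟨t, -, ht, hcov⟩ := (isCompact_closedBall (0 : Space) 1).finite_cover_balls (half_pos hδ)
  lift t to Finset Space using ht
  refine ⟨t.card, fun k => ?_⟩
  obtain ⟨ε, hε, hloc⟩ := D.exists_isLocal (k * n)
  refine ⟨ε, hε, fun c hc S hS => ?_⟩
  obtain ⟨z, hz, hlocal⟩ := hloc c hc
  let V : Space → Set X := fun e => {x ∈ S | direction z (D.pos x) ∈ Metric.ball e (δ / 2)}
  have hsub : D.code (k * n) '' S ⊆ ⋃ e ∈ t, D.code (k * n) '' V e := by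
    rintro _ ⟨x, hx, rfl⟩
    obtain ⟨e, he, hxe⟩ := mem_iUnion₂.1
      (hcov (mem_closedBall_zero_iff.2 (norm_direction_le z (D.pos x))))
    exact mem_iUnion₂.2 ⟨e, he, x, ⟨hx, hxe⟩, rfl⟩
  have hfin : (⋃ e ∈ t, D.code (k * n) '' V e).Finite :=
    t.finite_toSet.biUnion fun e _ => finite_image_itinerary _ _ _ _
  refine (ncard_le_ncard hsub hfin).trans
    ((Finset.set_ncard_biUnion_le t fun e => D.code (k * n) '' V e).trans ?_)
  rw [← smul_eq_mul]
  refine Finset.sum_le_card_nsmul _ _ _ fun e _ => ?_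
  refine D.ncard_code_sector_mul_le (δ := δ) (fun w hw w' hw' => hpar _ (mem_image_of_mem _ hw) _
    (mem_image_of_mem _ hw')) hz k (hlocal _ fun x hx => hS x hx.1) ?_
  intro x hx y hy
  rw [← dist_eq_norm]
  have := dist_triangle_right (direction z (D.pos x)) (direction z (D.pos y)) e
  linarith [Metric.mem_ball.1 hx.2, Metric.mem_ball.1 hy.2]

/-- Isometries preserve the size of small sets, so that the local bound can be iterated. -/
theorem exists_ncard_code_le [Finite ι] (n : ℕ) :
    ∃ K : ℕ, ∀ k : ℕ, ∃ C : ℕ, ∀ j : ℕ,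
      (D.code (j * (k * n)) '' univ).ncard ≤ C * (K * 3 ^ k) ^ j := by
  obtain ⟨K, hK⟩ := D.exists_ncard_code_ball_le n
  refine ⟨K, fun k => ?_⟩
  obtain ⟨ε, hε, hball⟩ := hK k
  obtain ⟨t, hts, ht, hcov⟩ := (isCompact_sphere (0 : Space) 1).finite_cover_balls hε
  lift t to Finset Space using ht
  refine ⟨t.card, fun j => ?_⟩
  let V : Space → Set X := fun c => {x | D.pos x ∈ Metric.ball c ε}
  have hsub : D.code (j * (k * n)) '' univ ⊆ ⋃ c ∈ t, D.code (j * (k * n)) '' V c := by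
    rintro _ ⟨x, -, rfl⟩
    obtain ⟨c, hc, hxc⟩ := mem_iUnion₂.1 (hcov (mem_sphere_zero_iff_norm.2 (D.norm_pos x)))
    exact mem_iUnion₂.2 ⟨c, hc, x, hxc, rfl⟩
  have hfin : (⋃ c ∈ t, D.code (j * (k * n)) '' V c).Finite :=
    t.finite_toSet.biUnion fun e _ => finite_image_itinerary _ _ _ _
  refine (ncard_le_ncard hsub hfin).trans
    ((Finset.set_ncard_biUnion_le t fun c => D.code (j * (k * n)) '' V c).trans ?_)
  rw [← smul_eq_mul]
  refine Finset.sum_le_card_nsmul _ _ _ fun c hc => ?_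
  refine ncard_itinerary_blocks_le _ _ j _ fun i _ u _ => ?_
  refine hball (D.rotWord u c) ?_ _ ?_
  · rw [LinearIsometryEquiv.norm_map]
    exact mem_sphere_zero_iff_norm.1 (hts hc)
  · rintro _ ⟨x, ⟨hx, hxu⟩, rfl⟩
    rw [pos_iterate, code, hxu, Metric.mem_ball, LinearIsometryEquiv.dist_map]
    exact hx

/-- A piecewise isometry of the sphere has zero entropy: the number of words grows slower than
every exponential. -/
theorem exists_ncard_code_le_exp [Finite ι] {h : ℝ} (hh : 0 < h) :
    ∃ C : ℝ, ∀ N : ℕ, ((D.code N '' univ).ncard : ℝ) ≤ C * Real.exp (h * N) := by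
  -- `n` is chosen so that the factor `3` per `n` steps is negligible, then `k` so that the
  -- factor `K` per `k * n` steps is.
  obtain ⟨n, hn⟩ := exists_nat_ge (Real.log 3 / (h / 2))
  rw [div_le_iff₀ (by positivity)] at hn
  have hn0 : 0 < n := by
    rcases n.eq_zero_or_pos with rfl | h0
    · have := Real.log_pos (by norm_num : (1 : ℝ) < 3)
      rw [Nat.cast_zero, zero_mul] at hn
      linarith
    · exact h0
  have h3 : (3 : ℝ) ≤ Real.exp (n * (h / 2)) := (Real.le_exp_log 3).trans (Real.exp_le_exp.2 hn)
  obtain ⟨K, hK⟩ := D.exists_ncard_code_le n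
  obtain ⟨k, hk⟩ := exists_nat_gt (Real.log (K + 1) / (h / 2))
  have hk0 : 0 < k := by
    have : 0 ≤ Real.log (K + 1) := Real.log_nonneg (by simp)
    exact_mod_cast lt_of_le_of_lt (by positivity : 0 ≤ Real.log (K + 1) / (h / 2)) hk
  rw [div_lt_iff₀ (by positivity)] at hk
  have hKk : (K : ℝ) ≤ Real.exp (k * n * (h / 2)) := by
    have hn1 : (1 : ℝ) ≤ n := by exact_mod_cast hn0
    have hkn : (k : ℝ) ≤ k * n := le_mul_of_one_le_right (Nat.cast_nonneg k) hn1
    have hlog : Real.log (K + 1) ≤ k * n * (h / 2) :=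
      hk.le.trans (mul_le_mul_of_nonneg_right hkn (half_pos hh).le)
    linarith [(Real.le_exp_log ((K : ℝ) + 1)).trans (Real.exp_le_exp.2 hlog)]
  obtain ⟨C, hC⟩ := hK k
  have hm : 0 < k * n := Nat.mul_pos hk0 hn0
  have hM : ((K * 3 ^ k : ℕ) : ℝ) ≤ Real.exp (h * (k * n)) := by
    push_cast
    calc (K : ℝ) * 3 ^ k ≤ Real.exp (k * n * (h / 2)) * Real.exp (n * (h / 2)) ^ k := by gcongr
      _ = Real.exp (h * (k * n)) := by
        rw [← Real.exp_nat_mul, ← Real.exp_add]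
        ring_nf
  refine ⟨C * Real.exp (h * (k * n)), fun N => ?_⟩
  have hN : N ≤ (N / (k * n) + 1) * (k * n) := by
    rw [mul_comm]
    exact (Nat.lt_mul_div_succ N hm).le
  have hle : ((D.code N '' univ).ncard : ℝ) ≤ C * ((K * 3 ^ k : ℕ) : ℝ) ^ (N / (k * n) + 1) := by
    exact_mod_cast (ncard_image_itinerary_mono _ _ hN univ).trans (hC _)
  refine hle.trans ?_
  rw [mul_assoc]
  refine mul_le_mul_of_nonneg_left ?_ (Nat.cast_nonneg C)
  refine (pow_le_pow_left₀ (Nat.cast_nonneg _) hM _).trans ?_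
  rw [← Real.exp_nat_mul, ← Real.exp_add, Real.exp_le_exp]
  have hq : ((N / (k * n) : ℕ) : ℝ) * (k * n) ≤ N := by
    exact_mod_cast Nat.div_mul_le_self N (k * n)
  push_cast at hq ⊢
  nlinarith

end PiecewiseIsometry

/-! ### The outer billiard as a piecewise isometry -/

/-- The cross product of two vectors, as a normal vector of the plane they span. -/
def normalOf (a b : Space) : Space := WithLp.toLp 2 (crossProduct a.ofLp b.ofLp)

theorem inner_normalOf (a b x : Space) : inner ℝ (normalOf a b) x = triple a b x := by
  simp only [normalOf, triple, Matrix.det_fin_three, PiLp.inner_apply, Fin.sum_univ_three,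
    cross_apply, Matrix.of_apply, Matrix.cons_val, RCLike.inner_apply, conj_trivial]
  ring

namespace ConvexPolygon

variable {p : ℕ} (P : ConvexPolygon p)

theorem outerBilliard_of_mem_face {x : Sphere2} {i : ZMod p} (hx : x ∈ P.face i) :
    P.outerBilliard x = geodesicSymmetry (P.vertex i) x := by
  have h : ∃ i, x ∈ P.face i := ⟨i, hx⟩
  rw [outerBilliard, dif_pos h, P.face_unique h.choose_spec hx]

variable {P} in
theorem IsRegular.outerBilliard {x : Sphere2} (hx : P.IsRegular x) :
    P.IsRegular (P.outerBilliard x) := fun k => hx (k + 1)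

variable {P} in
theorem IsRegular.iterate {x : Sphere2} (hx : P.IsRegular x) (m : ℕ) :
    P.IsRegular (P.outerBilliard^[m] x) := by
  induction m generalizing x with
  | zero => exact hx
  | succ m ih => exact ih hx.outerBilliard

/-- The normal vector of the great circle that carries the side `v i, v (i + 1)`. -/
def sideNormal (i : ZMod p) : Space := normalOf (P.vertex i) (P.vertex (i + 1))

theorem mem_face_iff {x : Sphere2} {i : ZMod p} : x ∈ P.face i ↔
    inner ℝ (P.sideNormal (i - 1)) (x : Space) < 0 ∧ 0 < inner ℝ (P.sideNormal i) (x : Space) := by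
  rw [sideNormal, sideNormal, inner_normalOf, inner_normalOf, sub_add_cancel]
  rfl

/-- The rotation by `π` about the axis through the vertex `v i`. -/
noncomputable def vertexSymmetry (i : ZMod p) : Space ≃ₗᵢ[ℝ] Space :=
  Submodule.reflection (Submodule.span ℝ {((P.vertex i : Sphere2) : Space)})

theorem coe_outerBilliard {x : Sphere2} {i : ZMod p} (hx : x ∈ P.face i) :
    (P.outerBilliard x : Space) = P.vertexSymmetry i x := by
  rw [P.outerBilliard_of_mem_face hx]
  rfl

/-- The outer billiard on its regular points, as a piecewise isometry with pieces bounded by the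
great circles that carry the sides of the polygon. -/
noncomputable def piecewiseIsometry : PiecewiseIsometry {x // P.IsRegular x} (ZMod p) where
  map x := ⟨P.outerBilliard x, x.2.outerBilliard⟩
  piece x := (x.2 0).choose
  pos x := (x : Sphere2)
  rot := P.vertexSymmetry
  normal := P.sideNormal
  norm_pos x := norm_eq_of_mem_sphere x.1
  pos_map x := P.coe_outerBilliard (x.2 0).choose_spec
  piece_eq_of_sign x y h := by
    refine P.face_unique (x := (y : Sphere2)) ?_ (y.2 0).choose_spec
    have hx := P.mem_face_iff.1 (x.2 0).choose_spec
    rw [mem_face_iff, ← sign_eq_neg_one_iff, ← sign_eq_one_iff, ← h, ← h, sign_eq_neg_one_iff,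
      sign_eq_one_iff]
    exact hx

theorem coe_map_iterate (k : ℕ) (x : {x // P.IsRegular x}) :
    ((P.piecewiseIsometry.map^[k] x : {x // P.IsRegular x}) : Sphere2) =
      P.outerBilliard^[k] x := by
  induction k generalizing x with
  | zero => rfl
  | succ k ih => exact ih _

theorem ncard_words_le (n : ℕ) :
    (P.words n).ncard ≤ (P.piecewiseIsometry.code n '' univ).ncard := by
  have : NeZero p := ⟨by have := P.three_le; omega⟩
  refine ncard_le_ncard_of_injOn List.ofFn ?_ List.ofFn_injective.injOn
    (finite_image_itinerary _ _ _ _)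
  rintro w ⟨x, hx, m, hw⟩
  refine ⟨⟨P.outerBilliard^[m] x, hx.iterate m⟩, mem_univ _, ?_⟩
  rw [PiecewiseIsometry.code, itinerary_eq_ofFn]
  congr 1
  funext k
  refine P.face_unique ((P.piecewiseIsometry.map^[k] _).2 0).choose_spec ?_
  have := hw k
  rw [add_comm, Function.iterate_add_apply] at this
  rw [Function.iterate_zero_apply, coe_map_iterate]
  exact this

/-! ### Existence of regular points -/

theorem outerBilliard_mem_phaseSpace {x : Sphere2} {i : ZMod p} (hx : x ∈ P.face i) :
    P.outerBilliard x ∈ P.phaseSpace := by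
  have hflip : ∀ j k, (j = i ∨ k = i) →
      triple (P.vertex j) (P.vertex k) (P.outerBilliard x) =
        -triple (P.vertex j) (P.vertex k) x := by
    intro j k hjk
    have hrot : (P.outerBilliard x : Space) =
        (2 * inner ℝ (P.vertex i : Space) (x : Space)) • (P.vertex i : Space) - (x : Space) := by
      rw [P.coe_outerBilliard hx, vertexSymmetry, Submodule.reflection_apply,
        Submodule.starProjection_singleton, norm_eq_of_mem_sphere]
      simp [mul_smul, two_smul]
    rw [hrot]
    rcases hjk with rfl | rfl <;>
    · simp only [triple, Matrix.det_fin_three, Matrix.of_apply, Matrix.cons_val]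
      simp
      ring
  have hneg : ∀ (a b : Space) (y : Sphere2), triple a b (-y : Sphere2) = -triple a b y := by
    intro a b y
    simp only [triple, Matrix.det_fin_three, Matrix.of_apply, Matrix.cons_val]
    simp
    ring
  refine ⟨fun h => ?_, fun h => ?_⟩
  · have h1 := h i
    rw [hflip _ _ (Or.inl rfl)] at h1
    linarith [hx.2]
  · have h1 := h (i - 1)
    rw [sub_add_cancel, hneg, hflip _ _ (Or.inr rfl)] at h1
    linarith [hx.1]

/-- A point of an open face is regular if it is not on any of the countably many great circles
that are mapped by some composition of the vertex symmetries to a circle carrying a side. -/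
theorem isRegular_of_generic {x : Sphere2} {i : ZMod p} (hx : x ∈ P.face i)
    (hgen : ∀ w, inner ℝ (P.piecewiseIsometry.wall w) (x : Space) ≠ 0) : P.IsRegular x := by
  have key : ∀ k : ℕ, (∃ j, P.outerBilliard^[k] x ∈ P.face j) ∧
      ∃ u, (P.outerBilliard^[k] x : Space) = P.piecewiseIsometry.rotWord u x := by
    intro k
    induction k with
    | zero => exact ⟨⟨i, hx⟩, [], rfl⟩
    | succ k ih =>
      obtain ⟨⟨j, hj⟩, u, hu⟩ := ih
      have hu' : (P.outerBilliard^[k + 1] x : Space) =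
          P.piecewiseIsometry.rotWord (u ++ [j]) x := by
        rw [Function.iterate_succ_apply', P.coe_outerBilliard hj, hu,
          PiecewiseIsometry.rotWord_append]
        rfl
      refine ⟨?_, _, hu'⟩
      have hmem : P.outerBilliard^[k + 1] x ∈ P.phaseSpace \ ⋃ l, P.ray l := by
        refine ⟨?_, fun hray => ?_⟩
        · rw [Function.iterate_succ_apply']
          exact P.outerBilliard_mem_phaseSpace hj
        · obtain ⟨l, s, t, -, -, hst⟩ := mem_iUnion.1 hray
          refine hgen (u ++ [j], l) ?_
          rw [PiecewiseIsometry.inner_wall, ← hu', hst]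
          change inner ℝ (P.sideNormal l) _ = 0
          rw [sideNormal, inner_normalOf]
          simp only [triple, Matrix.det_fin_three, Matrix.of_apply, Matrix.cons_val]
          simp
          ring
      rw [← P.iUnion_face] at hmem
      exact mem_iUnion.1 hmem
  exact fun k => (key k).1

theorem exists_isRegular : ∃ x, P.IsRegular x := by
  have : NeZero p := ⟨by have := P.three_le; omega⟩
  have hpos := P.triple_corner_pos
  have hcyc : ∀ a b c : Space, triple b c a = triple a b c := by
    intro a b c
    simp only [triple, Matrix.det_fin_three, Matrix.of_apply, Matrix.cons_val]
    ring
  have hzero : ∀ a b : Space, triple a b a = 0 ∧ triple a b b = 0 := by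
    intro a b
    simp only [triple, Matrix.det_fin_three, Matrix.of_apply, Matrix.cons_val]
    constructor <;> ring
  have hnormal : ∀ i, P.sideNormal i ≠ 0 := fun i h => by
    have h1 := hpos i
    rw [← hcyc, ← inner_normalOf, ← sideNormal, h, inner_zero_left] at h1
    exact lt_irrefl _ h1
  have hdense : Dense (⋂ w, {x : Space | inner ℝ (P.piecewiseIsometry.wall w) x ≠ 0}) := by
    refine dense_iInter_of_isOpen
      (fun w => isOpen_ne_fun (by fun_prop) continuous_const) fun w => ?_
    refine dense_setOf_inner_ne_zero fun h => hnormal w.2 ?_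
    exact (LinearIsometryEquiv.map_eq_zero_iff _).1 h
  -- The cone over the open face with corner `v 0`.
  let U : Set Space := {x | inner ℝ (P.sideNormal (0 - 1)) x < 0 ∧ 0 < inner ℝ (P.sideNormal 0) x}
  have hU : IsOpen U :=
    IsOpen.inter (s := {x : Space | inner ℝ (P.sideNormal (0 - 1)) x < 0})
      (t := {x : Space | 0 < inner ℝ (P.sideNormal 0) x})
      (isOpen_lt (by fun_prop) continuous_const) (isOpen_lt continuous_const (by fun_prop))
  have hUne : U.Nonempty := by
    refine ⟨(P.vertex (0 - 1) : Space) - (P.vertex (0 + 1) : Space), ?_, ?_⟩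
    · rw [inner_sub_right, sideNormal, sub_add_cancel, inner_normalOf, inner_normalOf,
        (hzero _ _).1]
      linarith [hpos 0]
    · rw [inner_sub_right, sideNormal, inner_normalOf, inner_normalOf, (hzero _ _).2, hcyc]
      linarith [hpos 0]
  obtain ⟨y, hyU, hy⟩ := hdense.inter_open_nonempty U hU hUne
  have hy0 : y ≠ 0 := fun h => by
    have := hyU.1
    rw [h, inner_zero_right] at this
    exact lt_irrefl _ this
  have hn : 0 < ‖y‖⁻¹ := inv_pos.2 (norm_pos_iff.2 hy0)
  let x : Sphere2 := ⟨‖y‖⁻¹ • y, by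
    rw [mem_sphere_zero_iff_norm, norm_smul, norm_inv, norm_norm,
      inv_mul_cancel₀ (norm_ne_zero_iff.2 hy0)]⟩
  refine ⟨x, P.isRegular_of_generic (i := 0) (P.mem_face_iff.2 ⟨?_, ?_⟩) fun w => ?_⟩
  · change inner ℝ _ (‖y‖⁻¹ • y) < 0
    rw [inner_smul_right]
    exact mul_neg_of_pos_of_neg hn hyU.1
  · change 0 < inner ℝ _ (‖y‖⁻¹ • y)
    rw [inner_smul_right]
    exact mul_pos hn hyU.2
  · change inner ℝ _ (‖y‖⁻¹ • y) ≠ 0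
    rw [inner_smul_right]
    exact mul_ne_zero hn.ne' (mem_iInter.1 hy w)

theorem complexity_pos (n : ℕ) : 0 < P.complexity n := by
  have : NeZero p := ⟨by have := P.three_le; omega⟩
  obtain ⟨x, hx⟩ := P.exists_isRegular
  refine (ncard_pos (toFinite _)).2 ⟨fun k => (hx k).choose, x, hx, 0, fun k => ?_⟩
  rw [zero_add]
  exact (hx k).choose_spec

end ConvexPolygon

/-! ### Subexponential growth -/

/-- A sequence of positive integers that is bounded by every exponential up to a factor is
subexponential. -/
theorem isSubexponential_of_forall_exists_le {f : ℕ → ℕ} (hpos : ∀ n, 0 < f n)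
    (hf : ∀ h : ℝ, 0 < h → ∃ C : ℝ, ∀ n : ℕ, (f n : ℝ) ≤ C * Real.exp (h * n)) :
    IsSubexponential fun n => (f n : ℝ) := by
  refine ⟨fun n => Nat.cast_pos.2 (hpos n), fun h hh => ?_⟩
  obtain ⟨C, hC⟩ := hf (h / 2) (half_pos hh)
  have hlim : Tendsto (fun n : ℕ => Real.exp (h / 2 * n)) atTop atTop :=
    Real.tendsto_exp_atTop.comp (tendsto_natCast_atTop_atTop.const_mul_atTop (half_pos hh))
  filter_upwards [hlim.eventually_gt_atTop C, eventually_gt_atTop 0] with n hn hn0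
  constructor
  · refine (hC n).trans_lt ?_
    have h2 : Real.exp (h * n) = Real.exp (h / 2 * n) * Real.exp (h / 2 * n) := by
      rw [← Real.exp_add]
      ring_nf
    rw [h2]
    exact mul_lt_mul_of_pos_right hn (Real.exp_pos _)
  · have h1 : (1 : ℝ) ≤ f n := by exact_mod_cast hpos n
    refine (inv_le_one_of_one_le₀ h1).trans_lt (Real.one_lt_exp_iff.2 ?_)
    have : (0 : ℝ) < n := by exact_mod_cast hn0
    positivity

end SphericalOuterBilliard

theorem theorem8 {p : ℕ} (P : SphericalOuterBilliard.ConvexPolygon p) :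
    SphericalOuterBilliard.IsSubexponential (fun n => (P.complexity n : ℝ)) := by
  have : NeZero p := ⟨by have := P.three_le; omega⟩
  refine SphericalOuterBilliard.isSubexponential_of_forall_exists_le P.complexity_pos
    fun h hh => ?_
  obtain ⟨C, hC⟩ := P.piecewiseIsometry.exists_ncard_code_le_exp hh
  exact ⟨C, fun n => le_trans (by exact_mod_cast P.ncard_words_le n) (hC n)⟩
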